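/- A *GNC-tree* (generalized non-crossing tree) with $m\ge 1$ points is a tree whose vertices are $m$ points on a circle and whose edges are straight chords that do not cross, together with a label in $\{1,2,\dots\}$ for each point such that, starting from the root (the first point labelled $1$) and going counterclockwise, the labels are weakly increasing, and such that if $j$ is a label then every $i$ with $1\le i\le j$ is also a label. Direct every edge away from the root; an edge from a point labelled $i$ to a point labelled $j$ is an *ascent* ($u$) if $i<j$, a *level* ($h$) if $i=j$, and a *descent* ($d$) if $i>j$. The tree is *alternating* if it has no level and no path going away from the root contains two consecutive ascents or two consecutive descents (i.e. it is $\{uu,dd,h\}$-avoiding). For $m\ge 1$ let $e_m$ (respectively $o_m$) be the number of alternating GNC-trees with $m$ points and an even (respectively odd) number of ascents. Then for every integer $n\ge 0$, $$e_{2n+3}-o_{2n+3}=0,\qquad e_{2n+2}-o_{2n+2}=(-1)^{n+1}2^nC_n,$$ where $C_n=\frac1{n+1}\binom{2n}{n}$ is the $n$th Catalan number. -/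

import Mathlib

/-- Two chords `{a, b}` and `{c, d}` of points numbered counterclockwise on a circle cross (meet in
the interior of the disc at a point that is not an endpoint) iff their endpoints strictly
interleave.  A graph drawn with straight chords is non-crossing iff no two of its edges do so. -/
def NonCrossing {n : ℕ} (G : SimpleGraph (Fin n)) : Prop :=
  ∀ a b c d : Fin n, G.Adj a b → G.Adj c d → ¬ (a < c ∧ c < b ∧ b < d)

/-- A rooted generalized non-crossing tree with `n + 1` points.  The points are `0, 1, …, n` in
counterclockwise order on a circle, starting from the first point labelled `1`, which is the
root. -/
@[ext]
structure GNCTree (n : ℕ) where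
  /-- the underlying graph on the `n + 1` points -/
  graph : SimpleGraph (Fin (n + 1))
  isTree : graph.IsTree
  nonCrossing : NonCrossing graph
  /-- the labels of the points -/
  label : Fin (n + 1) → ℕ
  label_pos : ∀ v, 1 ≤ label v
  label_mono : Monotone label
  /-- if `j` is a label, then every `1 ≤ i ≤ j` is a label -/
  label_full : ∀ j ∈ Set.range label, ∀ i, 1 ≤ i → i ≤ j → i ∈ Set.range label

/-- The letters encoding the edges: ascent `u`, level `h`, descent `d`. -/
inductive Letter
  | u
  | h
  | d
  deriving DecidableEq

/-- The letter of an edge that leads, away from the root, from label `i` to label `j`. -/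
def letterOf (i j : ℕ) : Letter :=
  if i < j then Letter.u else if i = j then Letter.h else Letter.d

namespace GNCTree

variable {n : ℕ}

/-- The word on `{u, h, d}` encoding a walk in the tree. -/
def word (T : GNCTree n) {v w : Fin (n + 1)} (p : T.graph.Walk v w) : List Letter :=
  p.darts.map fun e => letterOf (T.label e.fst) (T.label e.snd)

/-- The tree avoids the pattern `σ`: the word of no path starting at the root has a
contiguous subword equal to `σ`. -/
def Avoids (T : GNCTree n) (σ : List Letter) : Prop :=
  ∀ (v : Fin (n + 1)) (p : T.graph.Walk 0 v), p.IsPath → ¬ σ <:+: T.word p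

/-- Alternating means `{uu, dd, h}`-avoiding. -/
def IsAlternating (T : GNCTree n) : Prop :=
  T.Avoids [Letter.u, Letter.u] ∧ T.Avoids [Letter.d, Letter.d] ∧ T.Avoids [Letter.h]

/-- `(v, w)` is an edge directed away from the root: `v` and `w` are adjacent and `v` is on the
path from the root to `w`. -/
def IsEdgeFromRoot (T : GNCTree n) (v w : Fin (n + 1)) : Prop :=
  T.graph.Adj v w ∧ ∃ p : T.graph.Walk 0 w, p.IsPath ∧ v ∈ p.support

/-- The number of ascents of the tree. -/
noncomputable def ascents (T : GNCTree n) : ℕ :=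
  Set.ncard {e : Fin (n + 1) × Fin (n + 1) |
    T.IsEdgeFromRoot e.1 e.2 ∧ T.label e.1 < T.label e.2}

theorem label_le (T : GNCTree n) (v : Fin (n + 1)) : T.label v ≤ n + 1 := by
  have hsub : Finset.Icc 1 (T.label v) ⊆ Finset.univ.image T.label := by
    intro i hi
    rw [Finset.mem_Icc] at hi
    obtain ⟨w, hw⟩ := T.label_full _ ⟨v, rfl⟩ i hi.1 hi.2
    exact Finset.mem_image.2 ⟨w, Finset.mem_univ _, hw⟩
  have h1 := (Finset.card_le_card hsub).trans Finset.card_image_le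
  simpa using h1

/-- There are finitely many trees with `n + 1` points, so their cardinalities are meaningful. -/
instance : Finite (GNCTree n) := by
  refine Finite.of_injective
    (β := SimpleGraph (Fin (n + 1)) × (Fin (n + 1) → Fin (n + 2)))
    (fun T => (T.graph, fun v => ⟨T.label v, Nat.lt_succ_of_le (T.label_le v)⟩)) ?_
  intro S T hST
  simp only [Prod.mk.injEq] at hST
  refine GNCTree.ext hST.1 (funext fun v => ?_)
  simpa using congrFun hST.2 v

end GNCTree

/-- The number of alternating GNC-trees with `n + 1` points and an even number of ascents, minus
the number of those with an odd number of ascents. -/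
noncomputable def alternatingSignedCount (n : ℕ) : ℤ :=
  (Nat.card {T : GNCTree n // T.IsAlternating ∧ Even T.ascents} : ℤ) -
    (Nat.card {T : GNCTree n // T.IsAlternating ∧ Odd T.ascents} : ℤ)

/-! Avoiding `uu`, `dd` and `h` on root paths is a local condition (`GNCTree.isAlternating_iff`):
adjacent points have different labels, and no point has neighbours with both smaller and larger
labels. Labels weakly increase with position, so the graph is a non-crossing tree in which no point
has neighbours on both sides. On the points `a, …, b` with `a < b`, such a tree contains the chord
`(a, b)`, and deleting it leaves two trees of the same kind on `a, …, m` and `m + 1, …, b`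
(`IsNCAlt.split`). Hence these trees correspond to binary trees.

A labelling is the set of gaps at which it goes up by one. Every chord spans a chord joining
neighbouring points, so the only constraint is to go up under those short chords. They correspond to
cherries, which leaves `2 ^ (numNodes - cherries)` labellings. The ascents lead to the points that
are right ends of chords; their number is `rightLeaves`, whatever the labelling.

The signed count `s n` is therefore a weighted sum over binary trees. Splitting at the root, the
trees with exactly one empty subtree cancel, and `s (n + 1) = 2 * ∑ s i * s j - [n = 0]` over `i + j
= n`, with `s 0 = 0`. Parity kills the even terms; the odd ones satisfy a rescaled Catalan
recurrence. -/

/-! ### Non-crossing alternating trees and binary trees -/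

/-- The chords of the non-crossing alternating tree on the points `a, …, a + t.numNodes` that
corresponds to the binary tree `t`. -/
def chords : BinaryTree Unit → ℕ → Finset (ℕ × ℕ)
  | .nil, _ => ∅
  | .node _ l r, a =>
    insert (a, a + (l.numNodes + r.numNodes + 1)) (chords l a ∪ chords r (a + l.numNodes + 1))

/-- `E` is the edge set of a connected non-crossing graph on the points `a, …, b`, in which no point
has both a smaller and a larger neighbour. -/
structure IsNCAlt (E : Finset (ℕ × ℕ)) (a b : ℕ) : Prop where
  mem : ∀ x y, (x, y) ∈ E → a ≤ x ∧ x < y ∧ y ≤ b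
  noncrossing : ∀ x y z w, (x, y) ∈ E → (z, w) ∈ E → ¬ (x < z ∧ z < y ∧ y < w)
  alternating : ∀ x y z, (x, y) ∈ E → (y, z) ∉ E
  connected : ∀ x, a ≤ x → x ≤ b → Relation.EqvGen (fun x y => (x, y) ∈ E) a x

theorem Relation.EqvGen.map_of_forall {α β : Type*} {r : α → α → Prop} {s : β → β → Prop}
    (f : α → β) (h : ∀ x y, r x y → Relation.EqvGen s (f x) (f y)) {x y : α}
    (hxy : Relation.EqvGen r x y) : Relation.EqvGen s (f x) (f y) := by
  induction hxy with
  | rel x y hr => exact h x y hr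
  | refl x => exact .refl _
  | symm x y _ ih => exact .symm _ _ ih
  | trans x y z _ _ h1 h2 => exact .trans _ _ _ h1 h2

theorem Relation.EqvGen.iff_of_forall {α : Type*} {r : α → α → Prop} {p : α → Prop}
    (h : ∀ x y, r x y → (p x ↔ p y)) {x y : α} (hxy : Relation.EqvGen r x y) : p x ↔ p y := by
  induction hxy with
  | rel x y hr => exact h x y hr
  | refl x => exact Iff.rfl
  | symm x y _ ih => exact ih.symm
  | trans x y z _ _ h1 h2 => exact h1.trans h2

theorem mem_chords_node {u : Unit} {l r : BinaryTree Unit} {a x y : ℕ} :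
    (x, y) ∈ chords (.node u l r) a ↔ (x = a ∧ y = a + (l.numNodes + r.numNodes + 1)) ∨
      (x, y) ∈ chords l a ∨ (x, y) ∈ chords r (a + l.numNodes + 1) := by
  simp [chords]

theorem chords_bounds {t : BinaryTree Unit} {a x y : ℕ} (h : (x, y) ∈ chords t a) :
    a ≤ x ∧ x < y ∧ y ≤ a + t.numNodes := by
  induction t generalizing a with
  | nil => simp [chords] at h
  | node u l r ihl ihr =>
    rw [mem_chords_node] at h
    simp only [BinaryTree.numNodes]
    rcases h with h | h | h
    · omega
    · have := ihl h; omega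
    · have := ihr h; omega

theorem top_mem_chords {t : BinaryTree Unit} (ht : t ≠ .nil) (a : ℕ) :
    (a, a + t.numNodes) ∈ chords t a := by
  cases t with
  | nil => exact absurd rfl ht
  | node u l r => rw [mem_chords_node]; exact Or.inl ⟨rfl, rfl⟩

theorem isNCAlt_chords (t : BinaryTree Unit) (a : ℕ) : IsNCAlt (chords t a) a (a + t.numNodes) := by
  induction t generalizing a with
  | nil =>
    refine ⟨by simp [chords], by simp [chords], by simp [chords], fun x h1 h2 => ?_⟩
    obtain rfl : x = a := le_antisymm h2 h1
    exact .refl _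
  | node u l r ihl ihr =>
    have hl := ihl a
    have hr := ihr (a + l.numNodes + 1)
    refine ⟨fun x y h => chords_bounds h, fun x y z w h1 h2 => ?_, fun x y z h1 h2 => ?_,
      fun x h1 h2 => ?_⟩
    · rw [mem_chords_node] at h1 h2
      rcases h1 with h1 | h1 | h1 <;> rcases h2 with h2 | h2 | h2
      · omega
      · have := chords_bounds h2; omega
      · have := chords_bounds h2; omega
      · have := chords_bounds h1; omega
      · exact hl.noncrossing _ _ _ _ h1 h2
      · have := chords_bounds h1; have := chords_bounds h2; omega
      · have := chords_bounds h1; omega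
      · have := chords_bounds h1; have := chords_bounds h2; omega
      · exact hr.noncrossing _ _ _ _ h1 h2
    · rw [mem_chords_node] at h1 h2
      rcases h1 with h1 | h1 | h1 <;> rcases h2 with h2 | h2 | h2
      · omega
      · have := chords_bounds h2; omega
      · have := chords_bounds h2; omega
      · have := chords_bounds h1; omega
      · exact hl.alternating _ _ _ h1 h2
      · have := chords_bounds h1; have := chords_bounds h2; omega
      · have := chords_bounds h1; omega
      · have := chords_bounds h1; have := chords_bounds h2; omega
      · exact hr.alternating _ _ _ h1 h2
    · simp only [BinaryTree.numNodes] at h2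
      have right : ∀ y, a + l.numNodes + 1 ≤ y → y ≤ a + l.numNodes + 1 + r.numNodes →
          Relation.EqvGen (fun x y => (x, y) ∈ chords (.node u l r) a) (a + l.numNodes + 1) y :=
        fun y h1 h2 => (hr.connected y h1 h2).map_of_forall id fun x y h =>
          .rel _ _ (mem_chords_node.2 (Or.inr (Or.inr h)))
      rcases le_or_gt x (a + l.numNodes) with h | h
      · exact (hl.connected x h1 h).map_of_forall id fun x y h =>
          .rel _ _ (mem_chords_node.2 (Or.inr (Or.inl h)))
      · refine .trans _ _ _ (.rel _ _ (mem_chords_node.2 (Or.inl ⟨rfl, rfl⟩)))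
          (.trans _ _ _ (.symm _ _ (right _ ?_ ?_)) (right x h ?_)) <;> omega

namespace IsNCAlt

variable {E : Finset (ℕ × ℕ)} {a b : ℕ}

/-- A chord over the gap after `m` with left end strictly between `a` and `m` would cross `(a, m)`;
with left end `m ≠ a` it would give `m` neighbours on both sides. -/
theorem eq_left_of_le_of_lt (h : IsNCAlt E a b) {m x y : ℕ} (hm : m = a ∨ (a, m) ∈ E)
    (hxy : (x, y) ∈ E) (hx : x ≤ m) (hy : m < y) : x = a := by
  by_contra hne
  have hax := (h.mem x y hxy).1
  rcases hm with rfl | hm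
  · omega
  · rcases hx.lt_or_eq with hx | rfl
    · exact h.noncrossing a m x y hm hxy ⟨by omega, hx, hy⟩
    · exact h.alternating _ _ _ hm hxy

/-- Provides the cut point `m`; the value `m = a` covers the case where `a` has no neighbour below
`c`. -/
theorem exists_greatest_neighbor (E : Finset (ℕ × ℕ)) {a c : ℕ} (hac : a < c) :
    ∃ m, a ≤ m ∧ m < c ∧ (m = a ∨ (a, m) ∈ E) ∧ ∀ y, m < y → y < c → (a, y) ∉ E := by
  classical
  have hne : (((Finset.Ico a c).filter fun m => m = a ∨ (a, m) ∈ E)).Nonempty :=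
    ⟨a, by simp [hac]⟩
  obtain ⟨m, hm, hmax⟩ := Finset.exists_max_image _ id hne
  simp only [Finset.mem_filter, Finset.mem_Ico, id] at hm hmax
  refine ⟨m, hm.1.1, hm.1.2, hm.2, fun y hy hyc hE => ?_⟩
  have := hmax y ⟨⟨by omega, hyc⟩, Or.inr hE⟩
  omega

/-- Let `m` be the last neighbour of `a` before `b`. A chord leaving `{a, …, m}` starts at `a`, so
by maximality it is `(a, b)`. Without it, `{a, …, m}` would be a union of components missing `b`. -/
theorem top_mem (h : IsNCAlt E a b) (hab : a < b) : (a, b) ∈ E := by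
  obtain ⟨m, ham, hmb, hm, hmax⟩ := exists_greatest_neighbor E hab
  by_contra hE
  have key : (a ≤ m ↔ b ≤ m) := by
    refine Relation.EqvGen.iff_of_forall (p := fun x => x ≤ m) (fun x y hxy => ?_)
      (h.connected b hab.le le_rfl)
    have hb := h.mem x y hxy
    refine ⟨fun hx => ?_, fun hy => by omega⟩
    by_contra hy
    obtain rfl := h.eq_left_of_le_of_lt hm hxy hx (by omega)
    rcases hb.2.2.lt_or_eq with hlt | rfl
    · exact hmax y (by omega) hlt hxy
    · exact hE hxy
  omega

theorem split (h : IsNCAlt E a b) (hab : a < b) : ∃ m E₁ E₂, a ≤ m ∧ m < b ∧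
    IsNCAlt E₁ a m ∧ IsNCAlt E₂ (m + 1) b ∧ E = insert (a, b) (E₁ ∪ E₂) := by
  obtain ⟨m, ham, hmb, hm, hmax⟩ := exists_greatest_neighbor E hab
  have hsep : ∀ x y, (x, y) ∈ E → x ≤ m → m < y → x = a ∧ y = b := by
    intro x y hxy hx hy
    obtain rfl := h.eq_left_of_le_of_lt hm hxy hx hy
    refine ⟨rfl, ?_⟩
    by_contra hne
    exact hmax y hy (lt_of_le_of_ne (h.mem _ _ hxy).2.2 hne) hxy
  refine ⟨m, E.filter fun e => e.2 ≤ m, E.filter fun e => m < e.1, ham, hmb,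
    ⟨fun x y hxy => ?_, fun x y z w h1 h2 => ?_, fun x y z h1 h2 => ?_, fun x h1 h2 => ?_⟩,
    ⟨fun x y hxy => ?_, fun x y z w h1 h2 => ?_, fun x y z h1 h2 => ?_, fun x h1 h2 => ?_⟩, ?_⟩
  · rw [Finset.mem_filter] at hxy
    have := h.mem x y hxy.1
    exact ⟨this.1, this.2.1, hxy.2⟩
  · exact h.noncrossing x y z w (Finset.mem_filter.1 h1).1 (Finset.mem_filter.1 h2).1
  · exact h.alternating x y z (Finset.mem_filter.1 h1).1 (Finset.mem_filter.1 h2).1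
  -- Collapsing all points beyond `m` to `a` turns the only chord over the cut, `(a, b)`, into a
  -- loop and keeps the chords of the left part.
  · have key := (h.connected x h1 (by omega)).map_of_forall
      (s := fun x y => (x, y) ∈ E.filter fun e => e.2 ≤ m)
      (fun z => if z ≤ m then z else a) (fun z w hzw => ?_)
    · simpa [ham, h2] using key
    · have hb := h.mem z w hzw
      split_ifs with hz hw hw
      · exact .rel _ _ (Finset.mem_filter.2 ⟨hzw, hw⟩)
      · rw [(hsep z w hzw hz (by omega)).1]; exact .refl _
      · omega
      · exact .refl _
  · rw [Finset.mem_filter] at hxy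
    have := h.mem x y hxy.1
    exact ⟨hxy.2, this.2.1, this.2.2⟩
  · exact h.noncrossing x y z w (Finset.mem_filter.1 h1).1 (Finset.mem_filter.1 h2).1
  · exact h.alternating x y z (Finset.mem_filter.1 h1).1 (Finset.mem_filter.1 h2).1
  -- Symmetrically, the points up to `m` collapse to `b`; then `a` maps to `b`, so `m + 1` and `x`
  -- are both linked to `b`.
  · have aux : ∀ z w, (z, w) ∈ E → Relation.EqvGen (fun x y => (x, y) ∈ E.filter fun e => m < e.1)
        (if z ≤ m then b else z) (if w ≤ m then b else w) := by
      intro z w hzw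
      have hb := h.mem z w hzw
      split_ifs with hz hw hw
      · exact .refl _
      · rw [(hsep z w hzw hz (by omega)).2]; exact .refl _
      · omega
      · exact .rel _ _ (Finset.mem_filter.2 ⟨hzw, by simpa using hz⟩)
    have k1 := (h.connected x (by omega) h2).map_of_forall (fun z => if z ≤ m then b else z) aux
    have k2 := (h.connected (m + 1) (by omega) (by omega)).map_of_forall
      (fun z => if z ≤ m then b else z) aux
    have hx : ¬ x ≤ m := by omega
    simp only [ham, hx, if_true, if_false, show ¬ (m + 1 ≤ m) by omega] at k1 k2
    exact .trans _ _ _ (.symm _ _ k2) k1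
  · ext ⟨x, y⟩
    simp only [Finset.mem_insert, Finset.mem_union, Finset.mem_filter, Prod.mk.injEq]
    constructor
    · intro hxy
      by_cases hx : x ≤ m
      · by_cases hy : y ≤ m
        · exact Or.inr (Or.inl ⟨hxy, hy⟩)
        · exact Or.inl (hsep x y hxy hx (by omega))
      · exact Or.inr (Or.inr ⟨hxy, by omega⟩)
    · rintro (⟨rfl, rfl⟩ | hxy | hxy)
      · exact h.top_mem hab
      · exact hxy.1
      · exact hxy.1

theorem exists_tree (h : IsNCAlt E a b) (hab : a ≤ b) :
    ∃ t : BinaryTree Unit, a + t.numNodes = b ∧ chords t a = E := by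
  obtain ⟨n, hn⟩ : ∃ n, b - a = n := ⟨_, rfl⟩
  induction n using Nat.strong_induction_on generalizing E a b with
  | _ n ih =>
    rcases hab.eq_or_lt with rfl | hlt
    · refine ⟨.nil, rfl, (Finset.eq_empty_of_forall_notMem ?_).symm⟩
      rintro ⟨x, y⟩ hxy
      have := h.mem x y hxy
      omega
    · obtain ⟨m, E₁, E₂, ham, hmb, h1, h2, rfl⟩ := h.split hlt
      obtain ⟨l, hl, rfl⟩ := ih (m - a) (by omega) h1 ham rfl
      obtain ⟨r, hr, rfl⟩ := ih (b - (m + 1)) (by omega) h2 hmb rfl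
      refine ⟨.node () l r, by simp only [BinaryTree.numNodes]; omega, ?_⟩
      rw [chords, hl, show a + (l.numNodes + r.numNodes + 1) = b by omega]

end IsNCAlt

theorem chords_left_eq {u : Unit} {l r : BinaryTree Unit} {a : ℕ} :
    chords l a = (chords (.node u l r) a).filter fun e => e.2 ≤ a + l.numNodes := by
  ext ⟨x, y⟩
  rw [Finset.mem_filter, mem_chords_node]
  constructor
  · exact fun h => ⟨Or.inr (Or.inl h), (chords_bounds h).2.2⟩
  · rintro ⟨h | h | h, hy⟩
    · dsimp only at hy; omega
    · exact h
    · have := chords_bounds h; dsimp only at hy; omega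

theorem chords_right_eq {u : Unit} {l r : BinaryTree Unit} {a : ℕ} :
    chords r (a + l.numNodes + 1) =
      (chords (.node u l r) a).filter fun e => a + l.numNodes + 1 ≤ e.1 := by
  ext ⟨x, y⟩
  rw [Finset.mem_filter, mem_chords_node]
  constructor
  · exact fun h => ⟨Or.inr (Or.inr h), (chords_bounds h).1⟩
  · rintro ⟨h | h | h, hy⟩
    · dsimp only at hy; omega
    · have := chords_bounds h; dsimp only at hy; omega
    · exact h

/-- The longest chord at `a` other than the top one reveals the size of the left subtree: if `l`
were larger than `l'`, its top chord would have no place in the other tree. -/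
theorem numNodes_left_le_of_chords_eq {u u' : Unit} {l r l' r' : BinaryTree Unit} {a : ℕ}
    (hn : l.numNodes + r.numNodes = l'.numNodes + r'.numNodes)
    (h : chords (.node u l r) a = chords (.node u' l' r') a) : l.numNodes ≤ l'.numNodes := by
  by_contra hlt
  have hl : l ≠ .nil := by rintro rfl; simp at hlt
  have hm := (mem_chords_node (u := u) (r := r)).2 (Or.inr (Or.inl (top_mem_chords hl a)))
  rw [h, mem_chords_node] at hm
  rcases hm with hm | hm | hm
  · omega
  · have := chords_bounds hm; omega
  · have := chords_bounds hm; omega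

theorem chords_injective {t t' : BinaryTree Unit} {a : ℕ} (hn : t.numNodes = t'.numNodes)
    (h : chords t a = chords t' a) : t = t' := by
  induction t generalizing t' a with
  | nil =>
    cases t' with
    | nil => rfl
    | node => simp [BinaryTree.numNodes] at hn
  | node u l r ihl ihr =>
    cases t' with
    | nil => simp [BinaryTree.numNodes] at hn
    | node u' l' r' =>
      have hn' : l.numNodes + r.numNodes = l'.numNodes + r'.numNodes := by
        simpa [BinaryTree.numNodes] using hn
      have hl : l.numNodes = l'.numNodes := le_antisymm (numNodes_left_le_of_chords_eq hn' h)
        (numNodes_left_le_of_chords_eq hn'.symm h.symm)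
      have h1 : l = l' := ihl hl (a := a) (by
        rw [chords_left_eq (u := u) (r := r), h, hl, ← chords_left_eq])
      have h2 : r = r' := ihr (by omega) (a := a + l.numNodes + 1) (by
        rw [chords_right_eq (u := u), h, hl, ← chords_right_eq])
      rw [h1, h2]

/-- An upper bound suffices: connectedness of the graph supplies the opposite inequality. -/
theorem card_chords_le (t : BinaryTree Unit) (a : ℕ) : (chords t a).card ≤ t.numNodes := by
  induction t generalizing a with
  | nil => simp [chords]
  | node u l r ihl ihr =>
    rw [chords, BinaryTree.numNodes]
    refine (Finset.card_insert_le _ _).trans ?_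
    have := Finset.card_union_le (chords l a) (chords r (a + l.numNodes + 1))
    have := ihl a
    have := ihr (a + l.numNodes + 1)
    omega

/-- Going down through nonempty subtrees under the chord ends at a cherry. This reduces the label
condition on all chords to one on short chords. -/
theorem exists_short_chord {t : BinaryTree Unit} {a x y : ℕ} (h : (x, y) ∈ chords t a) :
    ∃ z, x ≤ z ∧ z < y ∧ (z, z + 1) ∈ chords t a := by
  induction t generalizing a x y with
  | nil => simp [chords] at h
  | node u l r ihl ihr =>
    rw [mem_chords_node] at h
    rcases h with ⟨rfl, rfl⟩ | h | h
    · by_cases hl : l = .nil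
      · by_cases hr : r = .nil
        · subst hl hr
          exact ⟨x, le_rfl, by simp, by simp [mem_chords_node]⟩
        · obtain ⟨z, h1, h2, h3⟩ := ihr (top_mem_chords hr (x + l.numNodes + 1))
          exact ⟨z, by omega, by omega, mem_chords_node.2 (Or.inr (Or.inr h3))⟩
      · obtain ⟨z, h1, h2, h3⟩ := ihl (top_mem_chords hl x)
        exact ⟨z, by omega, by omega, mem_chords_node.2 (Or.inr (Or.inl h3))⟩
    · obtain ⟨z, h1, h2, h3⟩ := ihl h
      exact ⟨z, h1, h2, mem_chords_node.2 (Or.inr (Or.inl h3))⟩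
    · obtain ⟨z, h1, h2, h3⟩ := ihr h
      exact ⟨z, h1, h2, mem_chords_node.2 (Or.inr (Or.inr h3))⟩

/-! ### Right ends and short chords as statistics of the binary tree -/

/-- The number of leaves of a binary tree that are right children. -/
def rightLeaves : BinaryTree Unit → ℕ
  | .nil => 0
  | .node _ l r => rightLeaves l + if r = .nil then 1 else rightLeaves r

/-- The number of nodes of a binary tree both of whose children are leaves. -/
def cherries : BinaryTree Unit → ℕ
  | .nil => 0
  | .node _ l r => if l = .nil ∧ r = .nil then 1 else cherries l + cherries r

theorem card_image_snd_chords (t : BinaryTree Unit) (a : ℕ) :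
    ((chords t a).image Prod.snd).card = rightLeaves t := by
  induction t generalizing a with
  | nil => simp [chords, rightLeaves]
  | node u l r ihl ihr =>
    have himg : (chords (.node u l r) a).image Prod.snd = (chords l a).image Prod.snd ∪
        insert (a + (l.numNodes + r.numNodes + 1))
          ((chords r (a + l.numNodes + 1)).image Prod.snd) := by
      rw [chords, Finset.image_insert, Finset.image_union, Finset.union_insert]
    have hdisj : Disjoint ((chords l a).image Prod.snd)
        (insert (a + (l.numNodes + r.numNodes + 1))
          ((chords r (a + l.numNodes + 1)).image Prod.snd)) := by
      rw [Finset.disjoint_left]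
      intro y hy hy'
      simp only [Finset.mem_insert, Finset.mem_image, Prod.exists, exists_eq_right] at hy hy'
      obtain ⟨x, hx⟩ := hy
      have := chords_bounds hx
      rcases hy' with hy' | ⟨x', hx'⟩
      · omega
      · have := chords_bounds hx'; omega
    rw [himg, Finset.card_union_of_disjoint hdisj, ihl, rightLeaves]
    split_ifs with hr
    · subst hr
      simp [chords]
    -- The top chord of a nonempty `r` already ends at the last point, so the root chord adds no new
    -- right end.
    · rw [Finset.insert_eq_of_mem, ihr]
      exact Finset.mem_image.2 ⟨_, top_mem_chords hr (a + l.numNodes + 1), by dsimp only; omega⟩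

theorem card_short_chords (t : BinaryTree Unit) (a : ℕ) :
    ((chords t a).filter fun e => e.2 = e.1 + 1).card = cherries t := by
  induction t generalizing a with
  | nil => simp [chords, cherries]
  | node u l r ihl ihr =>
    rw [cherries]
    split_ifs with h
    · obtain ⟨rfl, rfl⟩ := h
      simp [chords, Finset.filter_singleton]
    · have hlr : l.numNodes + r.numNodes ≠ 0 := by
        intro h0
        refine h ⟨?_, ?_⟩
        · cases l with
          | nil => rfl
          | node => simp [BinaryTree.numNodes] at h0
        · cases r with
          | nil => rfl
          | node => simp [BinaryTree.numNodes] at h0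
      rw [chords, Finset.filter_insert, if_neg (by dsimp only; omega), Finset.filter_union,
        Finset.card_union_of_disjoint, ihl, ihr]
      rw [Finset.disjoint_left]
      rintro ⟨x, y⟩ h1 h2
      have := chords_bounds (Finset.mem_filter.1 h1).1
      have := chords_bounds (Finset.mem_filter.1 h2).1
      omega

/-! ### Labellings as sets of gaps -/

/-- The labelling of `n + 1` points that starts with `1` and increases by `1` exactly at the gaps
in `S`. -/
def labelOfSteps {n : ℕ} (S : Finset (Fin n)) (v : Fin (n + 1)) : ℕ :=
  1 + (S.filter fun i => i.castSucc < v).card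

/-- The gaps at which a labelling increases. -/
def steps {n : ℕ} (f : Fin (n + 1) → ℕ) : Finset (Fin n) :=
  Finset.univ.filter fun i => f i.castSucc < f i.succ

section labels

variable {n : ℕ}

theorem labelOfSteps_zero (S : Finset (Fin n)) : labelOfSteps S 0 = 1 := by
  simp [labelOfSteps]

theorem labelOfSteps_succ (S : Finset (Fin n)) (i : Fin n) :
    labelOfSteps S i.succ = labelOfSteps S i.castSucc + if i ∈ S then 1 else 0 := by
  have h : (S.filter fun j => j.castSucc < i.succ) =
      (S.filter fun j => j.castSucc < i.castSucc) ∪ S.filter fun j => j = i := by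
    ext j
    simp only [Finset.mem_union, Finset.mem_filter, Fin.lt_def, Fin.val_castSucc, Fin.val_succ,
      Fin.ext_iff]
    constructor
    · rintro ⟨h1, h2⟩
      rcases (Nat.lt_succ_iff.1 h2).lt_or_eq with h | h
      · exact Or.inl ⟨h1, h⟩
      · exact Or.inr ⟨h1, h⟩
    · rintro (⟨h1, h2⟩ | ⟨h1, h2⟩) <;> exact ⟨h1, by omega⟩
  have hd : Disjoint (S.filter fun j => j.castSucc < i.castSucc) (S.filter fun j => j = i) := by
    rw [Finset.disjoint_filter]
    rintro j - h1 rfl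
    exact lt_irrefl _ h1
  rw [labelOfSteps, labelOfSteps, h, Finset.card_union_of_disjoint hd, Finset.filter_eq', add_assoc]
  split_ifs <;> simp

theorem labelOfSteps_mono (S : Finset (Fin n)) : Monotone (labelOfSteps S) := by
  intro v w hvw
  refine Nat.add_le_add_left (Finset.card_le_card ?_) 1
  intro i hi
  rw [Finset.mem_filter] at hi ⊢
  exact ⟨hi.1, hi.2.trans_le hvw⟩

theorem labelOfSteps_full (S : Finset (Fin n)) (v : Fin (n + 1)) (i : ℕ) (h1 : 1 ≤ i)
    (hi : i ≤ labelOfSteps S v) : i ∈ Set.range (labelOfSteps S) := by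
  induction v using Fin.induction with
  | zero =>
    rw [labelOfSteps_zero] at hi
    exact ⟨0, by rw [labelOfSteps_zero]; omega⟩
  | succ k ih =>
    rcases hi.lt_or_eq with hlt | rfl
    · refine ih ?_
      rw [labelOfSteps_succ] at hlt
      split_ifs at hlt <;> omega
    · exact ⟨_, rfl⟩

theorem steps_labelOfSteps (S : Finset (Fin n)) : steps (labelOfSteps S) = S := by
  ext i
  rw [steps, Finset.mem_filter, labelOfSteps_succ]
  by_cases h : i ∈ S <;> simp [h]

theorem labelOfSteps_lt {S : Finset (Fin n)} {i : Fin n} (hi : i ∈ S) {v w : Fin (n + 1)}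
    (hv : v ≤ i.castSucc) (hw : i.succ ≤ w) : labelOfSteps S v < labelOfSteps S w := by
  have h1 := labelOfSteps_mono S hv
  have h2 := labelOfSteps_mono S hw
  rw [labelOfSteps_succ, if_pos hi] at h2
  omega

theorem labelOfSteps_steps {f : Fin (n + 1) → ℕ} (hpos : ∀ v, 1 ≤ f v) (hmono : Monotone f)
    (hfull : ∀ j ∈ Set.range f, ∀ i, 1 ≤ i → i ≤ j → i ∈ Set.range f) :
    labelOfSteps (steps f) = f := by
  funext v
  induction v using Fin.induction with
  | zero =>
    rw [labelOfSteps_zero]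
    obtain ⟨w, hw⟩ := hfull _ ⟨0, rfl⟩ 1 le_rfl (hpos 0)
    exact le_antisymm (hpos 0) ((hmono (Fin.zero_le w)).trans_eq hw)
  | succ k ih =>
    rw [labelOfSteps_succ, ih]
    have hle : f k.castSucc ≤ f k.succ := hmono (Fin.castSucc_lt_succ).le
    -- A jump by two or more would skip the value `f k.castSucc + 1`, which by monotonicity cannot
    -- be taken elsewhere.
    have hle' : f k.succ ≤ f k.castSucc + 1 := by
      by_contra hlt
      obtain ⟨w, hw⟩ := hfull _ ⟨k.succ, rfl⟩ (f k.castSucc + 1) (by omega) (by omega)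
      rcases le_or_gt w k.castSucc with h | h
      · have := hmono h; omega
      · have := hmono (Fin.castSucc_lt_iff_succ_le.1 h); omega
    simp only [steps, Finset.mem_filter, Finset.mem_univ, true_and]
    split_ifs <;> omega

end labels

/-! ### The signed sum over binary trees -/

open BinaryTree in
theorem sum_treesOfNumNodesEq_succ {M : Type*} [AddCommMonoid M] (f : BinaryTree Unit → M) (n : ℕ) :
    ∑ t ∈ treesOfNumNodesEq (n + 1), f t = ∑ ij ∈ Finset.HasAntidiagonal.antidiagonal n,
      ∑ l ∈ treesOfNumNodesEq ij.1, ∑ r ∈ treesOfNumNodesEq ij.2, f (.node () l r) := by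
  rw [treesOfNumNodesEq_succ, Finset.sum_biUnion]
  · refine Finset.sum_congr rfl fun ij _ => ?_
    rw [pairwiseNode, Finset.sum_map, Finset.sum_product]
    rfl
  · intro x _ y _ hxy
    refine Finset.disjoint_left.2 fun t h1 h2 => ?_
    simp only [pairwiseNode, Finset.mem_map, Finset.mem_product, mem_treesOfNumNodesEq] at h1 h2
    obtain ⟨⟨l, r⟩, ⟨hl, hr⟩, rfl⟩ := h1
    obtain ⟨⟨l', r'⟩, ⟨hl', hr'⟩, h⟩ := h2
    obtain ⟨-, rfl, rfl⟩ := BinaryTree.node.inj h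
    exact hxy (Prod.ext (hl.symm.trans hl') (hr.symm.trans hr'))

theorem cherries_le_numNodes (t : BinaryTree Unit) : cherries t ≤ t.numNodes := by
  induction t with
  | nil => simp [cherries]
  | node u l r ihl ihr =>
    simp only [cherries, BinaryTree.numNodes]
    split_ifs <;> omega

/-- The signed number of alternating trees of shape `t`; the one-point tree is left out. -/
def signedWeight (t : BinaryTree Unit) : ℤ :=
  if t = .nil then 0 else (-1) ^ rightLeaves t * 2 ^ (t.numNodes - cherries t)

/-- The exponent `numNodes - cherries` grows by one at the root, except at a cherry, where both
counts are one. An empty right subtree contributes a right leaf, hence a sign. Since the empty tree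
has weight `0`, exactly one of the four terms survives in each case. -/
theorem signedWeight_node (u : Unit) (l r : BinaryTree Unit) :
    signedWeight (.node u l r) = 2 * (signedWeight l * signedWeight r) +
      2 * ((if l = .nil then 1 else 0) * signedWeight r) -
      2 * (signedWeight l * (if r = .nil then 1 else 0)) -
      (if l = .nil then 1 else 0) * (if r = .nil then 1 else 0) := by
  have hl := cherries_le_numNodes l
  have hr := cherries_le_numNodes r
  by_cases h1 : l = .nil <;> by_cases h2 : r = .nil
  · simp [signedWeight, h1, h2, rightLeaves, cherries]
  · have : r.numNodes + 1 - cherries r = r.numNodes - cherries r + 1 := by omega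
    simp [signedWeight, h1, h2, rightLeaves, cherries, this, pow_succ]
    ring
  · have : l.numNodes + 1 - cherries l = l.numNodes - cherries l + 1 := by omega
    simp [signedWeight, h1, h2, rightLeaves, cherries, this, pow_succ]
    ring
  · have : l.numNodes + r.numNodes + 1 - (cherries l + cherries r) =
        (l.numNodes - cherries l) + (r.numNodes - cherries r) + 1 := by omega
    simp [signedWeight, h1, h2, rightLeaves, cherries, this, pow_succ, pow_add]
    ring

/-- The signed number of alternating trees with `n + 1` points, for `n ≥ 1`. -/
def signedCount (n : ℕ) : ℤ := ∑ t ∈ BinaryTree.treesOfNumNodesEq n, signedWeight t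

theorem signedCount_zero : signedCount 0 = 0 := by
  simp [signedCount, signedWeight]

theorem sum_ite_eq_nil (n : ℕ) :
    (∑ t ∈ BinaryTree.treesOfNumNodesEq n, if t = .nil then (1 : ℤ) else 0) =
      if n = 0 then 1 else 0 := by
  rw [Finset.sum_ite_eq']
  simp [BinaryTree.mem_treesOfNumNodesEq, eq_comm]

theorem signedCount_succ (n : ℕ) :
    signedCount (n + 1) =
      2 * ∑ ij ∈ Finset.HasAntidiagonal.antidiagonal n, signedCount ij.1 * signedCount ij.2 -
        if n = 0 then 1 else 0 := by
  rw [signedCount, sum_treesOfNumNodesEq_succ]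
  simp only [signedWeight_node, Finset.sum_sub_distrib, Finset.sum_add_distrib, ← Finset.mul_sum,
    ← Finset.sum_mul, sum_ite_eq_nil]
  change 2 * ∑ ij ∈ Finset.HasAntidiagonal.antidiagonal n, signedCount ij.1 * signedCount ij.2 +
    2 * ∑ ij ∈ Finset.HasAntidiagonal.antidiagonal n, (if ij.1 = 0 then 1 else 0) * signedCount ij.2 -
    2 * ∑ ij ∈ Finset.HasAntidiagonal.antidiagonal n, signedCount ij.1 * (if ij.2 = 0 then 1 else 0) - _ = _
  -- The two linear terms have opposite signs and are exchanged by swapping the subtrees, so they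
  -- cancel.
  have h1 : ∑ ij ∈ Finset.HasAntidiagonal.antidiagonal n, (if ij.1 = 0 then 1 else 0) * signedCount ij.2 =
      ∑ ij ∈ Finset.HasAntidiagonal.antidiagonal n, signedCount ij.1 * (if ij.2 = 0 then 1 else 0) := by
    rw [← Finset.Nat.sum_antidiagonal_swap]
    exact Finset.sum_congr rfl fun _ _ => mul_comm _ _
  have h2 : (∑ ij ∈ Finset.HasAntidiagonal.antidiagonal n, (if ij.1 = 0 then (1 : ℤ) else 0) *
      (if ij.2 = 0 then 1 else 0)) = if n = 0 then 1 else 0 := by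
    cases n with
    | zero => simp
    | succ n => simp [Finset.Nat.sum_antidiagonal_succ]
  rw [h1, h2]
  ring

theorem signedCount_even_and_odd (n : ℕ) :
    signedCount (2 * n) = 0 ∧ signedCount (2 * n + 1) = (-1) ^ (n + 1) * 2 ^ n * (catalan n : ℤ) := by
  induction n using Nat.strong_induction_on with
  | _ n ih =>
    have heven : signedCount (2 * n) = 0 := by
      rcases n with _ | n
      · exact signedCount_zero
      · rw [show 2 * (n + 1) = 2 * n + 1 + 1 by ring, signedCount_succ, if_neg (by omega),
          Finset.sum_eq_zero, mul_zero, sub_zero]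
        rintro ⟨i, j⟩ hij
        rw [Finset.HasAntidiagonal.mem_antidiagonal] at hij
        dsimp only at hij ⊢
        -- Here `i + j` is odd, so one of the two indices is even and its factor vanishes.
        rcases Nat.even_or_odd' i with ⟨k, rfl | rfl⟩
        · rw [(ih k (by omega)).1, zero_mul]
        · obtain ⟨m, rfl⟩ : ∃ m, j = 2 * m := ⟨n - k, by omega⟩
          rw [(ih m (by omega)).1, mul_zero]
    refine ⟨heven, ?_⟩
    rcases n with _ | n
    · rw [signedCount_succ]
      simp [signedCount_zero]
    · rw [signedCount_succ, if_neg (by omega), sub_zero]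
      have hsum : ∑ ij ∈ Finset.HasAntidiagonal.antidiagonal n,
          signedCount (2 * ij.1 + 1) * signedCount (2 * ij.2 + 1) =
          ∑ ij ∈ Finset.HasAntidiagonal.antidiagonal (2 * (n + 1)), signedCount ij.1 * signedCount ij.2 := by
        refine Finset.sum_of_injOn (fun ij => (2 * ij.1 + 1, 2 * ij.2 + 1)) ?_ ?_ ?_ ?_
        · rintro ⟨i, j⟩ - ⟨k, l⟩ - h
          simp only [Prod.mk.injEq] at h ⊢
          omega
        · rintro ⟨i, j⟩ h
          simp only [Finset.mem_coe,
            Finset.HasAntidiagonal.mem_antidiagonal] at h ⊢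
          omega
        · rintro ⟨i, j⟩ h hni
          rw [Finset.HasAntidiagonal.mem_antidiagonal] at h
          dsimp only at h ⊢
          rcases Nat.even_or_odd' i with ⟨k, rfl | rfl⟩
          -- The index `i = 2 * (n + 1)` is beyond the induction hypothesis; it needs the even case
          -- just proved.
          · rcases (show k ≤ n + 1 by omega).lt_or_eq with hk | rfl
            · rw [(ih k hk).1, zero_mul]
            · rw [heven, zero_mul]
          · refine absurd ⟨(k, n - k), ?_, ?_⟩ hni
            · simp only [Finset.mem_coe,
                Finset.HasAntidiagonal.mem_antidiagonal]
              omega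
            · change (2 * k + 1, 2 * (n - k) + 1) = (2 * k + 1, j)
              rw [Prod.mk.injEq]
              omega
        · intro _ _; rfl
      rw [← hsum, catalan_succ', Nat.cast_sum, Finset.mul_sum, Finset.mul_sum]
      refine Finset.sum_congr rfl ?_
      rintro ⟨i, j⟩ h
      rw [Finset.HasAntidiagonal.mem_antidiagonal] at h
      dsimp only at h ⊢
      subst h
      rw [(ih i (by omega)).2, (ih j (by omega)).2]
      push_cast
      ring

/-! ### Alternation as a local condition -/

namespace GNCTree

variable {n : ℕ} (T : GNCTree n)

theorem word_concat {u v w : Fin (n + 1)} (p : T.graph.Walk u v) (h : T.graph.Adj v w) :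
    T.word (p.concat h) = T.word p ++ [letterOf (T.label v) (T.label w)] := by
  simp [word, SimpleGraph.Walk.darts_concat]

theorem exists_adj_of_mem_word {u v : Fin (n + 1)} {p : T.graph.Walk u v} {a : Letter}
    (h : a ∈ T.word p) :
    ∃ x y, T.graph.Adj x y ∧ letterOf (T.label x) (T.label y) = a := by
  obtain ⟨e, -, rfl⟩ := List.mem_map.1 h
  exact ⟨e.fst, e.snd, e.adj, rfl⟩

theorem exists_adj_adj_of_infix_word {u v : Fin (n + 1)} {p : T.graph.Walk u v} {a b : Letter}
    (h : [a, b] <:+: T.word p) :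
    ∃ x y z, T.graph.Adj x y ∧ T.graph.Adj y z ∧ letterOf (T.label x) (T.label y) = a ∧
      letterOf (T.label y) (T.label z) = b := by
  induction p with
  | nil => simp [word] at h
  | cons h1 p ih =>
    change [a, b] <:+: letterOf _ _ :: T.word p at h
    rcases List.infix_cons_iff.1 h with h | h
    · cases p with
      | nil => simp [word] at h
      | cons h2 p =>
        change [a, b] <+: letterOf _ _ :: letterOf _ _ :: T.word p at h
        rw [List.cons_prefix_cons, List.cons_prefix_cons] at h
        exact ⟨_, _, _, h1, h2, h.1.symm, h.2.1.symm⟩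
    · exact ih h

theorem exists_isPath (v : Fin (n + 1)) : ∃ p : T.graph.Walk 0 v, p.IsPath :=
  (T.isTree.existsUnique_path 0 v).exists

theorem label_zero_le (v : Fin (n + 1)) : T.label 0 ≤ T.label v := T.label_mono (Fin.zero_le v)

theorem label_ne_of_avoids (h : T.Avoids [Letter.h]) {v w : Fin (n + 1)} (hvw : T.graph.Adj v w) :
    T.label v ≠ T.label w := by
  intro heq
  obtain ⟨p, hp⟩ := T.exists_isPath v
  have key : ∀ {x y : Fin (n + 1)} (q : T.graph.Walk 0 x) (hxy : T.graph.Adj x y),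
      T.label x = T.label y → ¬ (q.concat hxy).IsPath := by
    intro x y q hxy hl hq
    refine h y _ hq ?_
    rw [word_concat, hl, letterOf, if_neg (lt_irrefl _), if_pos rfl]
    exact (List.suffix_append _ _).isInfix
  -- Either `w` is the parent of `v`, or the root path to `v` extends to `w`; in both cases a root
  -- path ends with this edge.
  by_cases hw : w ∈ p.support
  · obtain ⟨q, hq⟩ := T.exists_isPath w
    have := T.isTree.isAcyclic.path_concat hq hp hvw.symm hw
    exact key q hvw.symm heq.symm (this ▸ hp)
  · exact key p hvw heq (hp.concat hw hvw)

/-- A neighbour of `v` on the root path to `v` is its parent, so the path extends to any other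
neighbour and reads the two letters at its end. -/
theorem not_avoids_of_mem_support {x v w : Fin (n + 1)} {p : T.graph.Walk 0 v} (hp : p.IsPath)
    (hxv : T.graph.Adj x v) (hvw : T.graph.Adj v w) (hx : x ∈ p.support) (hxw : x ≠ w) :
    ¬ T.Avoids [letterOf (T.label x) (T.label v), letterOf (T.label v) (T.label w)] := by
  intro h
  have hac := T.isTree.isAcyclic
  obtain ⟨q, hq⟩ := T.exists_isPath x
  have hpq := hac.path_concat hq hp hxv hx
  have hw : w ∉ p.support := fun hw => hxw
    ((hac.eq_penultimate_of_adj_end hp hxv.symm hx).trans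
      (hac.eq_penultimate_of_adj_end hp hvw hw).symm)
  refine h w _ (hp.concat hw hvw) ?_
  rw [word_concat, hpq, word_concat, List.append_assoc]
  exact (List.suffix_append _ _).isInfix

/-- Suppose `v` had a smaller neighbour `x` and a larger one `w`. A smaller parent of `v` followed
by `w` gives `uu`; a larger parent followed by `x` gives `dd`. The root has no smaller neighbour,
its label being minimal. -/
theorem isAlternating_iff : T.IsAlternating ↔
    (∀ v w, T.graph.Adj v w → T.label v ≠ T.label w) ∧
      ∀ x v w, T.graph.Adj x v → T.graph.Adj v w →
        T.label x < T.label v → ¬ T.label v < T.label w := by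
  constructor
  · rintro ⟨huu, hdd, hh⟩
    refine ⟨fun v w => T.label_ne_of_avoids hh, fun x v w hxv hvw h1 h2 => ?_⟩
    obtain ⟨p, hp⟩ := T.exists_isPath v
    have up : ∀ y z, T.graph.Adj y v → T.graph.Adj v z → y ∈ p.support → T.label y < T.label v →
        ¬ T.label v < T.label z := by
      intro y z hy hz hyp h1 h2
      have := T.not_avoids_of_mem_support hp hy hz hyp (by rintro rfl; omega)
      rw [letterOf, letterOf, if_pos h1, if_pos h2] at this
      exact this huu
    have down : ∀ y z, T.graph.Adj y v → T.graph.Adj v z → y ∈ p.support →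
        T.label v < T.label y → ¬ T.label z < T.label v := by
      intro y z hy hz hyp h1 h2
      have := T.not_avoids_of_mem_support hp hy hz hyp (by rintro rfl; omega)
      rw [letterOf, letterOf, if_neg h1.not_gt, if_neg h2.not_gt, if_neg h1.ne', if_neg h2.ne']
        at this
      exact this hdd
    by_cases hnil : p.Nil
    · have := hnil.eq
      subst this
      have := T.label_zero_le x
      omega
    · have hy := p.adj_penultimate hnil
      have hyp : p.penultimate ∈ p.support := p.getVert_mem_support _
      rcases (T.label_ne_of_avoids hh hy).lt_or_gt with h | h
      · exact up _ _ hy hvw hyp h h2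
      · exact down _ _ hy hxv.symm hyp h h1
  · rintro ⟨hne, halt⟩
    have hu : ∀ i j, letterOf i j = .u → i < j := by
      intro i j h
      by_contra hlt
      rw [letterOf, if_neg hlt] at h
      split_ifs at h
    have hd : ∀ i j, letterOf i j = .d → j < i := by
      intro i j h
      rw [letterOf] at h
      split_ifs at h
      omega
    refine ⟨fun v p _ hσ => ?_, fun v p _ hσ => ?_, fun v p _ hσ => ?_⟩
    · obtain ⟨x, y, z, hxy, hyz, h1, h2⟩ := T.exists_adj_adj_of_infix_word hσ
      exact halt x y z hxy hyz (hu _ _ h1) (hu _ _ h2)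
    · obtain ⟨x, y, z, hxy, hyz, h1, h2⟩ := T.exists_adj_adj_of_infix_word hσ
      exact halt z y x hyz.symm hxy.symm (hd _ _ h2) (hd _ _ h1)
    · obtain ⟨x, y, hxy, h⟩ := T.exists_adj_of_mem_word (hσ.subset (List.mem_singleton_self _))
      rw [letterOf] at h
      split_ifs at h with h1 h2
      exact hne x y hxy h2

variable {T}

/-- An edge away from the root is determined by its far end. If a point has one smaller neighbour,
all its neighbours are smaller, its parent included, so the direction of edges can be forgotten. -/
theorem IsAlternating.ascents_eq (h : T.IsAlternating) :
    T.ascents = Set.ncard {w | ∃ v, T.graph.Adj v w ∧ T.label v < T.label w} := by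
  have hac := T.isTree.isAcyclic
  rw [T.isAlternating_iff] at h
  have himg : {w | ∃ v, T.graph.Adj v w ∧ T.label v < T.label w} =
      Prod.snd '' {e : Fin (n + 1) × Fin (n + 1) |
        T.IsEdgeFromRoot e.1 e.2 ∧ T.label e.1 < T.label e.2} := by
    ext w
    constructor
    · rintro ⟨v, hvw, hlt⟩
      obtain ⟨p, hp⟩ := T.exists_isPath w
      have hnil : ¬ p.Nil := by
        intro hnil
        have := hnil.eq
        subst this
        have := T.label_zero_le v
        omega
      have hy := p.adj_penultimate hnil
      refine ⟨(p.penultimate, w), ⟨⟨hy, p, hp, p.getVert_mem_support _⟩, ?_⟩, rfl⟩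
      exact (h.1 _ _ hy).lt_or_gt.resolve_right (h.2 v w _ hvw hy.symm hlt)
    · rintro ⟨⟨v, w⟩, ⟨⟨hvw, -⟩, hlt⟩, rfl⟩
      exact ⟨v, hvw, hlt⟩
  rw [himg, Set.InjOn.ncard_image, ascents]
  rintro ⟨v, w⟩ ⟨⟨hvw, p, hp, hv⟩, -⟩ ⟨v', w'⟩ ⟨⟨hvw', p', hp', hv'⟩, -⟩ hw
  dsimp only at hw hvw hvw' p p' hp hp' hv hv'
  subst hw
  obtain rfl : p = p' := (T.isTree.existsUnique_path 0 w).unique hp hp'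
  rw [Prod.mk.injEq]
  exact ⟨(hac.eq_penultimate_of_adj_end hp hvw.symm hv).trans
    (hac.eq_penultimate_of_adj_end hp hvw'.symm hv').symm, rfl⟩

end GNCTree

/-! ### Alternating GNC-trees from binary trees and sets of gaps -/

/-- The graph on the points `0, …, n` with edge set `E`. -/
def graphOfChords (n : ℕ) (E : Finset (ℕ × ℕ)) : SimpleGraph (Fin (n + 1)) :=
  SimpleGraph.fromRel fun v w => ((v : ℕ), (w : ℕ)) ∈ E

namespace IsNCAlt

variable {n : ℕ} {E : Finset (ℕ × ℕ)}

theorem adj_of_mem (h : IsNCAlt E 0 n) {v w : Fin (n + 1)} (hvw : ((v : ℕ), (w : ℕ)) ∈ E) :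
    (graphOfChords n E).Adj v w := by
  rw [graphOfChords, SimpleGraph.fromRel_adj]
  refine ⟨?_, Or.inl hvw⟩
  rintro rfl
  exact lt_irrefl _ (h.mem _ _ hvw).2.1

theorem mem_of_adj (h : IsNCAlt E 0 n) {v w : Fin (n + 1)} (hvw : (graphOfChords n E).Adj v w)
    (hlt : v < w) : ((v : ℕ), (w : ℕ)) ∈ E := by
  rw [graphOfChords, SimpleGraph.fromRel_adj] at hvw
  refine hvw.2.resolve_right fun hmem => ?_
  have := (h.mem _ _ hmem).2.1
  rw [Fin.lt_def] at hlt
  omega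

theorem nonCrossing (h : IsNCAlt E 0 n) : NonCrossing (graphOfChords n E) := by
  rintro a b c d hab hcd ⟨h1, h2, h3⟩
  exact h.noncrossing _ _ _ _ (h.mem_of_adj hab (h1.trans h2)) (h.mem_of_adj hcd (h2.trans h3))
    ⟨h1, h2, h3⟩

theorem graphOfChords_connected (h : IsNCAlt E 0 n) : (graphOfChords n E).Connected := by
  have key : ∀ x y, Relation.EqvGen (fun x y => (x, y) ∈ E) x y →
      (graphOfChords n E).Reachable (Fin.ofNat (n + 1) x) (Fin.ofNat (n + 1) y) := by
    intro x y hxy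
    induction hxy with
    | rel x y hr =>
      have hb := h.mem x y hr
      refine (h.adj_of_mem ?_).reachable
      rwa [Fin.val_ofNat, Fin.val_ofNat, Nat.mod_eq_of_lt (by omega), Nat.mod_eq_of_lt (by omega)]
    | refl x => exact .refl _
    | symm x y _ ih => exact ih.symm
    | trans x y z _ _ h1 h2 => exact h1.trans h2
  have key' : ∀ v, (graphOfChords n E).Reachable (Fin.ofNat (n + 1) 0) v := by
    intro v
    have := key 0 v (h.connected v (Nat.zero_le _) (by omega))
    rwa [Fin.ofNat_val_eq_self] at this
  exact ⟨fun v w => (key' v).symm.trans (key' w)⟩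

theorem isTree_of_card_le (h : IsNCAlt E 0 n) (hcard : E.card ≤ n) :
    (graphOfChords n E).IsTree := by
  rw [SimpleGraph.isTree_iff_connected_and_card]
  refine ⟨h.graphOfChords_connected, le_antisymm ?_
    h.graphOfChords_connected.card_vert_le_card_edgeSet_add_one⟩
  rw [Nat.card_fin, Nat.card_coe_set_eq]
  refine Nat.add_le_add_right (le_trans ?_ hcard) 1
  have hsub : (graphOfChords n E).edgeSet ⊆
      (fun e : ℕ × ℕ => s(Fin.ofNat (n + 1) e.1, Fin.ofNat (n + 1) e.2)) '' (E : Set (ℕ × ℕ)) := by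
    intro e
    induction e with
    | h v w =>
      intro hvw
      rw [SimpleGraph.mem_edgeSet] at hvw
      rcases hvw.ne.lt_or_gt with hlt | hlt
      · exact ⟨_, h.mem_of_adj hvw hlt, by simp⟩
      · exact ⟨_, h.mem_of_adj hvw.symm hlt, by simp [Sym2.eq_swap]⟩
  refine (Set.ncard_le_ncard hsub (Set.toFinite _)).trans
    ((Set.ncard_image_le (Set.toFinite _)).trans ?_)
  rw [Set.ncard_coe_finset]

end IsNCAlt

theorem isNCAlt_chords_zero {n : ℕ} {t : BinaryTree Unit} (ht : t.numNodes = n) :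
    IsNCAlt (chords t 0) 0 n := by
  simpa [ht] using isNCAlt_chords t 0

/-- The gaps spanned by the chords that join neighbouring points. -/
def shortGaps (n : ℕ) (t : BinaryTree Unit) : Finset (Fin n) :=
  Finset.univ.filter fun i => ((i : ℕ), (i : ℕ) + 1) ∈ chords t 0

theorem mem_shortGaps {n : ℕ} {t : BinaryTree Unit} {i : Fin n} :
    i ∈ shortGaps n t ↔ ((i : ℕ), (i : ℕ) + 1) ∈ chords t 0 := by
  simp [shortGaps]

theorem card_shortGaps {n : ℕ} {t : BinaryTree Unit} (ht : t.numNodes = n) :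
    (shortGaps n t).card = cherries t := by
  rw [← card_short_chords t 0]
  refine Finset.card_bij (fun i _ => ((i : ℕ), (i : ℕ) + 1)) ?_ ?_ ?_
  · intro i hi
    exact Finset.mem_filter.2 ⟨mem_shortGaps.1 hi, rfl⟩
  · intro i _ j _ hij
    exact Fin.ext (Prod.mk.inj hij).1
  · rintro ⟨x, y⟩ hxy
    obtain ⟨hmem, h⟩ := Finset.mem_filter.1 hxy
    dsimp only at h
    subst h
    have := chords_bounds hmem
    exact ⟨⟨x, by omega⟩, mem_shortGaps.2 hmem, rfl⟩

namespace GNCTree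

variable {n : ℕ}

/-- The tree whose graph is given by the binary tree `t` and whose labels increase at the gaps
in `S`. -/
def ofChords (t : BinaryTree Unit) (ht : t.numNodes = n) (S : Finset (Fin n)) : GNCTree n where
  graph := graphOfChords n (chords t 0)
  isTree := (isNCAlt_chords_zero ht).isTree_of_card_le (ht ▸ card_chords_le t 0)
  nonCrossing := (isNCAlt_chords_zero ht).nonCrossing
  label := labelOfSteps S
  label_pos _ := Nat.le_add_right _ _
  label_mono := labelOfSteps_mono S
  label_full := by
    rintro _ ⟨v, rfl⟩ i h1 hi
    exact labelOfSteps_full S v i h1 hi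

variable {t : BinaryTree Unit} {ht : t.numNodes = n} {S : Finset (Fin n)}

theorem ofChords_inj {t' : BinaryTree Unit} {ht' : t'.numNodes = n} {S' : Finset (Fin n)}
    (h : ofChords t ht S = ofChords t' ht' S') : t = t' ∧ S = S' := by
  have hg : graphOfChords n (chords t 0) = graphOfChords n (chords t' 0) := congrArg graph h
  have hl : labelOfSteps S = labelOfSteps S' := congrArg label h
  have hsub : ∀ {t t' : BinaryTree Unit}, t.numNodes = n → t'.numNodes = n →
      graphOfChords n (chords t 0) = graphOfChords n (chords t' 0) →
      chords t 0 ⊆ chords t' 0 := by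
    rintro t t' ht ht' hg ⟨x, y⟩ hxy
    have hb := (isNCAlt_chords_zero ht).mem x y hxy
    have hadj := (isNCAlt_chords_zero ht).adj_of_mem (v := ⟨x, by omega⟩) (w := ⟨y, by omega⟩) hxy
    rw [hg] at hadj
    exact (isNCAlt_chords_zero ht').mem_of_adj hadj hb.2.1
  refine ⟨chords_injective (ht.trans ht'.symm) ((hsub ht ht' hg).antisymm (hsub ht' ht hg.symm)),
    ?_⟩
  rw [← steps_labelOfSteps S, hl, steps_labelOfSteps]

/-- A short chord joins different labels only if its gap is in `S`. Conversely every chord spans a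
short one, so its labels differ, and a path with increasing labels moves rightwards, which the chord
set forbids for two consecutive edges. -/
theorem ofChords_isAlternating_iff :
    (ofChords t ht S).IsAlternating ↔ shortGaps n t ⊆ S := by
  have hE := isNCAlt_chords_zero ht
  rw [isAlternating_iff]
  change ((∀ v w, (graphOfChords n (chords t 0)).Adj v w → labelOfSteps S v ≠ labelOfSteps S w) ∧
      ∀ x v w, (graphOfChords n (chords t 0)).Adj x v → (graphOfChords n (chords t 0)).Adj v w →
        labelOfSteps S x < labelOfSteps S v → ¬ labelOfSteps S v < labelOfSteps S w) ↔ _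
  constructor
  · rintro ⟨hne, -⟩ i hi
    have h := hne i.castSucc i.succ (hE.adj_of_mem (by simpa using mem_shortGaps.1 hi))
    rw [labelOfSteps_succ] at h
    by_contra hS
    rw [if_neg hS, add_zero] at h
    exact h rfl
  · intro hS
    have hlt : ∀ v w : Fin (n + 1), ((v : ℕ), (w : ℕ)) ∈ chords t 0 →
        labelOfSteps S v < labelOfSteps S w := by
      intro v w hvw
      obtain ⟨z, h1, h2, h3⟩ := exists_short_chord hvw
      exact labelOfSteps_lt (i := ⟨z, by omega⟩) (hS (mem_shortGaps.2 h3))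
        (by simpa [Fin.le_def] using h1) (by simpa [Fin.le_def] using h2)
    refine ⟨fun v w hvw => ?_, fun x v w hxv hvw h1 h2 => ?_⟩
    · rcases hvw.ne.lt_or_gt with h | h
      · exact (hlt v w (hE.mem_of_adj hvw h)).ne
      · exact (hlt w v (hE.mem_of_adj hvw.symm h)).ne'
    · exact hE.alternating _ _ _
        (hE.mem_of_adj hxv ((labelOfSteps_mono S).reflect_lt h1))
        (hE.mem_of_adj hvw ((labelOfSteps_mono S).reflect_lt h2))

theorem ascents_ofChords (h : (ofChords t ht S).IsAlternating) :
    (ofChords t ht S).ascents = rightLeaves t := by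
  have hE := isNCAlt_chords_zero ht
  rw [h.ascents_eq, ← card_image_snd_chords t 0, ← Set.ncard_coe_finset,
    ← Set.ncard_image_of_injective _ Fin.val_injective]
  congr 1
  ext y
  simp only [Set.mem_image, Set.mem_ofPred_eq, Finset.coe_image, Finset.mem_coe, Prod.exists,
    exists_eq_right]
  constructor
  · rintro ⟨w, ⟨v, hvw, hlt⟩, rfl⟩
    exact ⟨v, hE.mem_of_adj hvw ((labelOfSteps_mono S).reflect_lt hlt)⟩
  · rintro ⟨x, hxy⟩
    have hb := hE.mem x y hxy
    have hadj := hE.adj_of_mem (v := ⟨x, by omega⟩) (w := ⟨y, by omega⟩) hxy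
    refine ⟨⟨y, by omega⟩, ⟨⟨x, by omega⟩, hadj, ?_⟩, rfl⟩
    exact lt_of_le_of_ne (labelOfSteps_mono S hb.2.1.le)
      (((isAlternating_iff _).1 h).1 _ _ hadj)

/-- Labels differ along edges and are monotone, so they increase strictly from left to right on
every chord; the alternation of labels thus becomes that of positions. -/
theorem IsAlternating.exists_eq_ofChords {T : GNCTree n} (h : T.IsAlternating) :
    ∃ (t : BinaryTree Unit) (ht : t.numNodes = n) (S : Finset (Fin n)), T = ofChords t ht S := by
  classical
  rw [isAlternating_iff] at h
  have hlt : ∀ {v w}, T.graph.Adj v w → v < w → T.label v < T.label w := fun hvw h1 =>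
    lt_of_le_of_ne (T.label_mono h1.le) (h.1 _ _ hvw)
  obtain ⟨E, hE⟩ : ∃ E : Finset (ℕ × ℕ), ∀ x y, (x, y) ∈ E ↔
      ∃ v w : Fin (n + 1), (T.graph.Adj v w ∧ v < w) ∧ (v : ℕ) = x ∧ (w : ℕ) = y := by
    refine ⟨(Finset.univ.filter fun e : Fin (n + 1) × Fin (n + 1) =>
      T.graph.Adj e.1 e.2 ∧ e.1 < e.2).image fun e => ((e.1 : ℕ), (e.2 : ℕ)), fun x y => ?_⟩
    simp
  have hE' : ∀ v w : Fin (n + 1), ((v : ℕ), (w : ℕ)) ∈ E ↔ T.graph.Adj v w ∧ v < w := by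
    intro v w
    rw [hE]
    constructor
    · rintro ⟨v', w', h, hv, hw⟩
      rwa [Fin.ext hv, Fin.ext hw] at h
    · exact fun h => ⟨v, w, h, rfl, rfl⟩
  have hN : IsNCAlt E 0 n := by
    refine ⟨fun x y hxy => ?_, fun x y z w hxy hzw => ?_, fun x y z hxy hyz => ?_,
      fun x _ hx => ?_⟩
    · obtain ⟨v, w, ⟨-, hvw⟩, rfl, rfl⟩ := (hE _ _).1 hxy
      exact ⟨Nat.zero_le _, hvw, by omega⟩
    · obtain ⟨a, b, ⟨hab, -⟩, rfl, rfl⟩ := (hE _ _).1 hxy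
      obtain ⟨c, d, ⟨hcd, -⟩, rfl, rfl⟩ := (hE _ _).1 hzw
      exact T.nonCrossing a b c d hab hcd
    · obtain ⟨a, b, ⟨hab, hab'⟩, rfl, rfl⟩ := (hE _ _).1 hxy
      obtain ⟨b', c, ⟨hbc, hbc'⟩, hb, rfl⟩ := (hE _ _).1 hyz
      obtain rfl := Fin.ext hb
      exact h.2 a b' c hab hbc (hlt hab hab') (hlt hbc hbc')
    · have key : ∀ v w : Fin (n + 1), T.graph.Walk v w →
          Relation.EqvGen (fun x y => (x, y) ∈ E) v w := by
        intro v w p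
        induction p with
        | nil => exact .refl _
        | cons hadj p ih =>
          refine .trans _ _ _ ?_ ih
          rcases hadj.ne.lt_or_gt with h | h
          · exact .rel _ _ ((hE' _ _).2 ⟨hadj, h⟩)
          · exact .symm _ _ (.rel _ _ ((hE' _ _).2 ⟨hadj.symm, h⟩))
      obtain ⟨p, -⟩ := T.exists_isPath ⟨x, by omega⟩
      exact key _ _ p
  obtain ⟨t, ht, htE⟩ := hN.exists_tree (Nat.zero_le n)
  rw [Nat.zero_add] at ht
  refine ⟨t, ht, steps T.label, GNCTree.ext ?_
    (labelOfSteps_steps T.label_pos T.label_mono T.label_full).symm⟩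
  ext v w
  simp only [ofChords, graphOfChords, SimpleGraph.fromRel_adj, htE, hE']
  constructor
  · intro hvw
    rcases hvw.ne.lt_or_gt with h | h
    · exact ⟨hvw.ne, Or.inl ⟨hvw, h⟩⟩
    · exact ⟨hvw.ne, Or.inr ⟨hvw.symm, h⟩⟩
  · rintro ⟨-, h | h⟩
    · exact h.1
    · exact h.1.symm

end GNCTree

/-! ### The signed count of alternating trees -/

open scoped Classical in
theorem card_even_sub_card_odd {α : Type*} [Fintype α] (p : α → Prop) (f : α → ℕ) :
    (Nat.card {x // p x ∧ Even (f x)} : ℤ) - (Nat.card {x // p x ∧ Odd (f x)} : ℤ) =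
      ∑ x ∈ Finset.univ.filter p, (-1) ^ f x := by
  rw [Nat.card_eq_fintype_card, Nat.card_eq_fintype_card, Fintype.card_subtype,
    Fintype.card_subtype, ← Finset.filter_filter, ← Finset.filter_filter, Finset.card_filter,
    Finset.card_filter, Nat.cast_sum, Nat.cast_sum, ← Finset.sum_sub_distrib]
  refine Finset.sum_congr rfl fun x _ => ?_
  rcases Nat.even_or_odd (f x) with h | h
  · simp [h, Nat.not_odd_iff_even.2 h, h.neg_one_pow]
  · simp [h, Nat.not_even_iff_odd.2 h, h.neg_one_pow]

/-- The labellings allowed for a shape form the interval of sets from its short gaps to all gaps,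
and all carry the same sign. The one-point tree is excluded because it counts `1` but has weight
`0`. -/
theorem alternatingSignedCount_eq {n : ℕ} (hn : n ≠ 0) :
    alternatingSignedCount n = signedCount n := by
  classical
  have := Fintype.ofFinite (GNCTree n)
  rw [alternatingSignedCount, card_even_sub_card_odd]
  have hsum : ∑ x ∈ (BinaryTree.treesOfNumNodesEq n).sigma
        (fun t => Finset.Icc (shortGaps n t) Finset.univ), (-1 : ℤ) ^ rightLeaves x.1 =
      ∑ T ∈ Finset.univ.filter (fun T : GNCTree n => T.IsAlternating), (-1) ^ T.ascents := by
    have hmem : ∀ x : (_ : BinaryTree Unit) × Finset (Fin n),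
        x ∈ (BinaryTree.treesOfNumNodesEq n).sigma
          (fun t => Finset.Icc (shortGaps n t) Finset.univ) ↔
        x.1.numNodes = n ∧ shortGaps n x.1 ⊆ x.2 := by
      intro x
      simp [BinaryTree.mem_treesOfNumNodesEq]
    refine Finset.sum_bij (fun x hx => GNCTree.ofChords x.1 ((hmem x).1 hx).1 x.2) ?_ ?_ ?_ ?_
    · intro x hx
      exact Finset.mem_filter.2
        ⟨Finset.mem_univ _, GNCTree.ofChords_isAlternating_iff.2 ((hmem x).1 hx).2⟩
    · rintro ⟨t, S⟩ _ ⟨t', S'⟩ _ h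
      obtain ⟨rfl, rfl⟩ := GNCTree.ofChords_inj h
      rfl
    · intro T hT
      have hT := (Finset.mem_filter.1 hT).2
      obtain ⟨t, ht, S, rfl⟩ := hT.exists_eq_ofChords
      exact ⟨⟨t, S⟩, (hmem _).2 ⟨ht, GNCTree.ofChords_isAlternating_iff.1 hT⟩, rfl⟩
    · intro x hx
      rw [GNCTree.ascents_ofChords (GNCTree.ofChords_isAlternating_iff.2 ((hmem x).1 hx).2)]
  rw [← hsum, Finset.sum_sigma, signedCount]
  refine Finset.sum_congr rfl fun t ht => ?_
  rw [BinaryTree.mem_treesOfNumNodesEq] at ht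
  have hnil : t ≠ .nil := by
    rintro rfl
    exact hn ht.symm
  change ∑ _S ∈ Finset.Icc (shortGaps n t) Finset.univ, (-1 : ℤ) ^ rightLeaves t = _
  rw [Finset.sum_const, Finset.card_Icc_finset (Finset.subset_univ _), card_shortGaps ht,
    Finset.card_univ, Fintype.card_fin, signedWeight, if_neg hnil, ht, nsmul_eq_mul, mul_comm]
  push_cast
  rfl

/-- `alternatingSignedCount k` refers to trees with `k + 1` points, so the two parts are about
`2 * n + 3` points and `2 * n + 2` points. -/
theorem mainTheorem9 (n : ℕ) :
    alternatingSignedCount (2 * n + 2) = 0 ∧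
      alternatingSignedCount (2 * n + 1) = (-1) ^ (n + 1) * 2 ^ n * (catalan n : ℤ) := by
  rw [alternatingSignedCount_eq (by omega), alternatingSignedCount_eq (by omega)]
  exact ⟨(signedCount_even_and_odd (n + 1)).1, (signedCount_even_and_odd n).2⟩
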